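/- For a topological space $Y$, the Effros Borel structure on the family $\mathcal{F}(Y)$ of all closed subsets of $Y$ is the $\sigma$-algebra generated by the sets $\{F \in \mathcal{F}(Y) : F \cap U \neq \emptyset\}$, where $U$ ranges over the open subsets of $Y$. Let $\mathcal{SE}(C([0,1]))$ be the set of all closed linear subspaces of the real Banach space $C([0,1])$ of continuous functions $[0,1] \to \mathbb{R}$ with the supremum norm, equipped with the $\sigma$-algebra inherited from the Effros Borel structure on $\mathcal{F}(C([0,1]))$. Let $\Xi$ be a standard Borel space and let $\{(X_\xi, \|\cdot\|_\xi)\}_{\xi \in \Xi}$ be a system of real Banach spaces, each of which contains a sequence $x^\xi_1, x^\xi_2, \dots$ whose linear span is dense in $X_\xi$. Assume that the function $$\xi \mapsto \Big\| \sum_{k=1}^{n} \lambda_k x^\xi_k \Big\|_\xi$$ is Borel whenever $n \in \mathbb{N}$ and $\lambda_1, \dots, \lambda_n \in \mathbb{R}$. Then there exists a Borel mapping $\mathfrak{S} : \Xi \to \mathcal{SE}(C([0,1]))$ such that $\mathfrak{S}(\xi)$ is linearly isometric to $X_\xi$ for every $\xi \in \Xi$. -/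

import Mathlib

open TopologicalSpace

/-- The Effros Borel structure on the family `𝓕(X)` of all closed subsets of a topological space
`X` (the empty set included): the σ-algebra generated by the sets `{F | F ∩ U ≠ ∅}`, `U` open. -/
instance effrosMeasurableSpace (X : Type*) [TopologicalSpace X] : MeasurableSpace (Closeds X) :=
  MeasurableSpace.generateFrom
    {A | ∃ U : Set X, IsOpen U ∧ A = {F : Closeds X | ((F : Set X) ∩ U).Nonempty}}

/-- `SE(X)`, the family of all closed linear subspaces of a real normed space `X`. -/
abbrev SE (X : Type*) [NormedAddCommGroup X] [NormedSpace ℝ X] : Type _ :=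
  ClosedSubmodule ℝ X

/-- `SE(X)` is a subspace of `𝓕(X)`: its σ-algebra is the trace of the Effros Borel structure,
that is, the one induced by the (injective) inclusion `SE(X) → 𝓕(X)`. -/
instance seMeasurableSpace (X : Type*) [NormedAddCommGroup X] [NormedSpace ℝ X] :
    MeasurableSpace (SE X) :=
  MeasurableSpace.comap (fun F : SE X => F.toCloseds) (effrosMeasurableSpace X)

/-!
The proof is a measurable version of the Banach–Mazur theorem. Rescaling the vectors `x ξ k` by
positive Borel factors, one may take `‖x ξ k‖ ≤ 2⁻ᵏ`, so that `c ↦ ∑ cₖ • x ξ k` defines a bounded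
operator `T ξ` with dense range from the Hilbert space `H = ℓ²` to `X ξ`. The adjoint of `T ξ` maps
the dual unit ball of `X ξ` onto the closed convex set `K ξ = {h | ∀ c, ⟪c, h⟫ ≤ ‖T ξ c‖}`
(`adjointBall`), which lies in the fixed Hilbert cube `|hₖ| ≤ 2⁻ᵏ` and, by Hahn–Banach, satisfies
`‖T ξ c‖ = max {⟪c, h⟫ | h ∈ K ξ}`.

Let `γ : [0,1] → H` be a continuous curve whose image contains the Hilbert cube
(`exists_curve_covering_hilbertCube`), and let `P ξ` be the nearest-point projection onto `K ξ`.
Then `P ξ ∘ γ` is a continuous curve with image exactly `K ξ`, hence `c ↦ ⟪P ξ (γ ·), c⟫`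
(`curveEval`) is a linear map `H → C([0,1])` with `‖curveEval c‖ = ‖T ξ c‖`. It induces an isometry
of `X ξ` onto the closure of its range (`nonempty_linearIsometryEquiv_curveSpace`).

Projecting a fixed curve, rather than parametrizing each `K ξ` separately, is what makes the
dependence on `ξ` Borel. By Moreau's theorem `P ξ` is the gradient of the envelope
`h ↦ inf_c (‖h - c‖² / 2 + ‖T ξ c‖)`; the infimum may be taken over a countable dense set, so the
envelope is Borel in `ξ`, and `⟪P ξ h, c⟫` is a limit of its difference quotients
(`measurable_inner_adjointBallProj`). Thus the functions `curveEval c`, with `c` in a countable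
dense subset of `H`, are Borel in `ξ` and dense in the space constructed, which gives Effros
measurability (`measurable_SE_of_selectors`).
-/

open Filter Topology
open scoped RealInnerProductSpace unitInterval

/-! ### The adjoint image of the dual ball and its projection -/

section AdjointBall

variable {H E : Type*} [NormedAddCommGroup H] [InnerProductSpace ℝ H]
  [NormedAddCommGroup E] [NormedSpace ℝ E]

/-- The image of the closed dual unit ball of `E` under the adjoint of `T : H →L[ℝ] E`, described
through its support function `c ↦ ‖T c‖`. -/
def adjointBall (T : H →L[ℝ] E) : Set H := {h | ∀ c, ⟪c, h⟫ ≤ ‖T c‖}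

lemma isClosed_adjointBall (T : H →L[ℝ] E) : IsClosed (adjointBall T) := by
  simp only [adjointBall, Set.ofPred_forall]
  exact isClosed_iInter fun c => isClosed_le (by fun_prop) (by fun_prop)

lemma convex_adjointBall (T : H →L[ℝ] E) : Convex ℝ (adjointBall T) := by
  intro h hh k hk a b ha hb hab c
  rw [inner_add_right, inner_smul_right, inner_smul_right]
  calc a * ⟪c, h⟫ + b * ⟪c, k⟫ ≤ a * ‖T c‖ + b * ‖T c‖ := by gcongr; exacts [hh c, hk c]
    _ = ‖T c‖ := by rw [← add_mul, hab, one_mul]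

lemma zero_mem_adjointBall (T : H →L[ℝ] E) : (0 : H) ∈ adjointBall T := fun c => by simp

lemma abs_inner_le_of_mem_adjointBall {T : H →L[ℝ] E} {h : H} (hh : h ∈ adjointBall T) (c : H) :
    |⟪c, h⟫| ≤ ‖T c‖ :=
  abs_le'.2 ⟨hh c, by simpa using hh (-c)⟩

lemma inner_sub_le_moreau_term {T : H →L[ℝ] E} {k : H} (hk : k ∈ adjointBall T) (h c : H) :
    ⟪k, h⟫ - ‖k‖ ^ 2 / 2 ≤ ‖h - c‖ ^ 2 / 2 + ‖T c‖ := by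
  have h₁ := hk c
  have h₂ : ‖h - c - k‖ ^ 2 = ‖h - c‖ ^ 2 - 2 * (⟪k, h⟫ - ⟪c, k⟫) + ‖k‖ ^ 2 := by
    rw [norm_sub_sq_real, inner_sub_left, real_inner_comm h k]
  nlinarith [sq_nonneg ‖h - c - k‖]

/-- The Moreau envelope of the seminorm `c ↦ ‖T c‖`. The infimum is taken over a dense sequence of
`H`, which keeps it countable and does not change its value. -/
noncomputable def moreauEnvelope [SeparableSpace H] (T : H →L[ℝ] E) (h : H) : ℝ :=
  ⨅ i, (‖h - denseSeq H i‖ ^ 2 / 2 + ‖T (denseSeq H i)‖)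

lemma inner_sub_le_moreauEnvelope [SeparableSpace H] {T : H →L[ℝ] E} {k : H}
    (hk : k ∈ adjointBall T) (h : H) :
    ⟪k, h⟫ - ‖k‖ ^ 2 / 2 ≤ moreauEnvelope T h :=
  le_ciInf fun _ => inner_sub_le_moreau_term hk h _

variable [CompleteSpace H]

/-- The set `adjointBall T` is norming for `E` along `T`; this is the Hahn–Banach theorem. -/
lemma exists_mem_adjointBall_inner_eq (T : H →L[ℝ] E) (c : H) :
    ∃ h ∈ adjointBall T, ⟪c, h⟫ = ‖T c‖ := by
  obtain ⟨g, hg, hgc⟩ := exists_dual_vector'' ℝ (T c)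
  have key : ∀ x, ⟪x, (InnerProductSpace.toDual ℝ H).symm (g.comp T)⟫ = g (T x) := fun x => by
    rw [real_inner_comm, InnerProductSpace.toDual_symm_apply, ContinuousLinearMap.comp_apply]
  refine ⟨(InnerProductSpace.toDual ℝ H).symm (g.comp T), fun x => ?_, ?_⟩
  · rw [key]
    exact (le_abs_self _).trans (g.le_of_opNorm_le hg _ |>.trans_eq (one_mul _))
  · rw [key, hgc]; rfl

lemma exists_variational_adjointBall (T : H →L[ℝ] E) (u : H) :
    ∃ v ∈ adjointBall T, ∀ w ∈ adjointBall T, ⟪u - v, w - v⟫ ≤ 0 := by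
  obtain ⟨v, hv, h⟩ := exists_norm_eq_iInf_of_complete_convex ⟨0, zero_mem_adjointBall T⟩
    (isClosed_adjointBall T).isComplete (convex_adjointBall T) u
  exact ⟨v, hv, (norm_eq_iInf_iff_real_inner_le_zero (convex_adjointBall T) hv).1 h⟩

/-- The nearest-point projection of the Hilbert space `H` onto the closed convex set
`adjointBall T`. -/
noncomputable def adjointBallProj (T : H →L[ℝ] E) (u : H) : H :=
  (exists_variational_adjointBall T u).choose

lemma adjointBallProj_mem (T : H →L[ℝ] E) (u : H) : adjointBallProj T u ∈ adjointBall T :=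
  (exists_variational_adjointBall T u).choose_spec.1

lemma inner_sub_adjointBallProj_le (T : H →L[ℝ] E) (u : H) {w : H} (hw : w ∈ adjointBall T) :
    ⟪u - adjointBallProj T u, w - adjointBallProj T u⟫ ≤ 0 :=
  (exists_variational_adjointBall T u).choose_spec.2 w hw

lemma adjointBallProj_of_mem {T : H →L[ℝ] E} {u : H} (hu : u ∈ adjointBall T) :
    adjointBallProj T u = u := by
  have h := inner_sub_adjointBallProj_le T u hu
  rw [real_inner_self_eq_norm_sq] at h
  have : ‖u - adjointBallProj T u‖ = 0 := by nlinarith [norm_nonneg (u - adjointBallProj T u)]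
  exact (sub_eq_zero.1 (norm_eq_zero.1 this)).symm

lemma norm_adjointBallProj_sub_le (T : H →L[ℝ] E) (u v : H) :
    ‖adjointBallProj T u - adjointBallProj T v‖ ≤ ‖u - v‖ := by
  set p := adjointBallProj T u with hp
  set q := adjointBallProj T v with hq
  have h₁ : ⟪u - p, q - p⟫ ≤ 0 := inner_sub_adjointBallProj_le T u (adjointBallProj_mem T v)
  have h₂ : ⟪v - q, p - q⟫ ≤ 0 := inner_sub_adjointBallProj_le T v (adjointBallProj_mem T u)
  have h₃ : ⟪u - p, q - p⟫ + ⟪v - q, p - q⟫ = ⟪p - q, p - q⟫ - ⟪u - v, p - q⟫ := by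
    simp only [inner_sub_left, inner_sub_right]; ring
  have h₄ := real_inner_le_norm (u - v) (p - q)
  rw [real_inner_self_eq_norm_sq] at h₃
  by_contra! hlt
  nlinarith [norm_nonneg (u - v)]

lemma continuous_adjointBallProj (T : H →L[ℝ] E) : Continuous (adjointBallProj T) :=
  (LipschitzWith.of_dist_le_mul (K := 1) fun u v => by
    simpa [dist_eq_norm] using norm_adjointBallProj_sub_le T u v).continuous

variable [SeparableSpace H]

/-- Moreau's decomposition: the infimum defining the envelope at `h` is attained at `h - p`, where
`p` is the projection of `h` onto `adjointBall T`. -/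
lemma moreauEnvelope_eq (T : H →L[ℝ] E) (h : H) :
    moreauEnvelope T h = ⟪adjointBallProj T h, h⟫ - ‖adjointBallProj T h‖ ^ 2 / 2 := by
  refine le_antisymm ?_ (inner_sub_le_moreauEnvelope (adjointBallProj_mem T h) h)
  set p := adjointBallProj T h with hp
  have hT : ‖T (h - p)‖ ≤ ⟪h - p, p⟫ := by
    obtain ⟨k, hk, hke⟩ := exists_mem_adjointBall_inner_eq T (h - p)
    have := inner_sub_adjointBallProj_le T h hk
    rw [← hp, inner_sub_right, hke] at this
    linarith
  -- The point `c = h - p` attains the value; density of the sequence then suffices.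
  have hval : ‖h - (h - p)‖ ^ 2 / 2 + ‖T (h - p)‖ ≤ ⟪p, h⟫ - ‖p‖ ^ 2 / 2 := by
    rw [inner_sub_left, real_inner_self_eq_norm_sq, real_inner_comm p h] at hT
    rw [sub_sub_cancel]
    linarith
  refine le_of_forall_gt_imp_ge_of_dense fun a ha => ?_
  have hcont : Continuous fun c : H => ‖h - c‖ ^ 2 / 2 + ‖T c‖ := by fun_prop
  obtain ⟨i, hi⟩ := (denseRange_denseSeq H).exists_mem_open (hcont.isOpen_preimage _ isOpen_Iio)
    ⟨h - p, hval.trans_lt ha⟩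
  refine (ciInf_le ⟨0, ?_⟩ i).trans (le_of_lt hi)
  rintro _ ⟨j, rfl⟩
  positivity

/-- The gradient of the Moreau envelope at `h` is the projection of `h` onto `adjointBall T`;
here along the sequence of steps `1 / (n + 1)` in the direction `c`. -/
lemma tendsto_moreauEnvelope_slope (T : H →L[ℝ] E) (h c : H) :
    Tendsto (fun n : ℕ => ((n : ℝ) + 1) *
      (moreauEnvelope T (h + (1 / ((n : ℝ) + 1)) • c) - moreauEnvelope T h))
      atTop (𝓝 ⟪adjointBallProj T h, c⟫) := by
  have hlim : Tendsto (fun n : ℕ => h + (1 / ((n : ℝ) + 1)) • c) atTop (𝓝 h) := by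
    simpa using (tendsto_const_nhds (x := h)).add
      ((tendsto_one_div_add_atTop_nhds_zero_nat (𝕜 := ℝ)).smul_const c)
  have hup : Tendsto (fun n : ℕ => ⟪adjointBallProj T (h + (1 / ((n : ℝ) + 1)) • c), c⟫) atTop
      (𝓝 ⟪adjointBallProj T h, c⟫) :=
    (((continuous_adjointBallProj T).tendsto h).comp hlim).inner tendsto_const_nhds
  refine tendsto_of_tendsto_of_tendsto_of_le_of_le tendsto_const_nhds hup (fun n => ?_) fun n => ?_
  -- The envelope is at least `⟪p, ·⟫ - ‖p‖² / 2` for every `p ∈ adjointBall T`, with equality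
  -- at the points projecting to `p`. Take for `p` the projection of `h`, respectively of `h'`.
  all_goals
    have hn : (0 : ℝ) < (n : ℝ) + 1 := by positivity
    set h' := h + (1 / ((n : ℝ) + 1)) • c with hh'
    have hexp : ∀ p : H, ((n : ℝ) + 1) * (⟪p, h'⟫ - ⟪p, h⟫) = ⟪p, c⟫ := fun p => by
      rw [hh', inner_add_right, inner_smul_right]; field_simp; ring
  · have := inner_sub_le_moreauEnvelope (adjointBallProj_mem T h) h'
    dsimp only
    rw [moreauEnvelope_eq T h, ← hexp]
    exact mul_le_mul_of_nonneg_left (by linarith) hn.le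
  · have := inner_sub_le_moreauEnvelope (adjointBallProj_mem T h') h
    dsimp only
    rw [moreauEnvelope_eq T h', ← hexp]
    exact mul_le_mul_of_nonneg_left (by linarith) hn.le

end AdjointBall

/-! ### Measurable dependence on the parameter -/

section Measurability

/-- If the support functions of the sets `adjointBall (T ξ)` depend measurably on `ξ`, so do the
nearest-point projections onto these sets. -/
lemma measurable_inner_adjointBallProj {Ξ H : Type*} [MeasurableSpace Ξ] [NormedAddCommGroup H]
    [InnerProductSpace ℝ H] [CompleteSpace H] [SeparableSpace H] {X : Ξ → Type*}
    [∀ ξ, NormedAddCommGroup (X ξ)] [∀ ξ, NormedSpace ℝ (X ξ)] (T : ∀ ξ, H →L[ℝ] X ξ)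
    (hT : ∀ c, Measurable fun ξ => ‖T ξ c‖) (h c : H) :
    Measurable fun ξ => ⟪adjointBallProj (T ξ) h, c⟫ := by
  have henv : ∀ h, Measurable fun ξ => moreauEnvelope (T ξ) h := fun h =>
    Measurable.iInf fun i => (hT _).const_add _
  exact measurable_of_tendsto_metrizable (fun n => ((henv _).sub (henv _)).const_mul _)
    (tendsto_pi_nhds.2 fun ξ => tendsto_moreauEnvelope_slope (T ξ) h c)

/-- A map into `C([0,1], ℝ)` is Borel as soon as all its evaluations are: it is the pointwise limit
of its Bernstein approximations, which involve only finitely many evaluations each. -/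
lemma measurable_continuousMap_of_eval {Ξ : Type*} [MeasurableSpace Ξ]
    [MeasurableSpace C(I, ℝ)] [BorelSpace C(I, ℝ)] {f : Ξ → C(I, ℝ)}
    (hf : ∀ t, Measurable fun ξ => f ξ t) : Measurable f := by
  refine measurable_of_tendsto_metrizable (f := fun n ξ => bernsteinApproximation n (f ξ))
    (fun n => ?_) (tendsto_pi_nhds.2 fun ξ => bernsteinApproximation_uniform (f ξ))
  refine Finset.measurable_sum _ fun k _ => ?_
  have hc : Continuous fun r : ℝ => bernstein n k • ContinuousMap.const I r := by
    have : Continuous fun r : ℝ => ContinuousMap.const I r := ContinuousMap.continuous_const'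
    fun_prop
  exact hc.measurable.comp (hf _)

/-- A family of closed subspaces is Borel for the Effros structure if it has a countable family of
Borel selectors that is dense in each member. -/
lemma measurable_SE_of_selectors {Ξ F ι : Type*} [MeasurableSpace Ξ] [NormedAddCommGroup F]
    [NormedSpace ℝ F] [MeasurableSpace F] [BorelSpace F] [Countable ι] {S : Ξ → SE F}
    (f : ι → Ξ → F) (hf : ∀ i, Measurable (f i))
    (hS : ∀ ξ, (S ξ : Set F) = closure (Set.range fun i => f i ξ)) : Measurable S := by
  refine measurable_comap_iff.2 (measurable_generateFrom ?_)
  rintro _ ⟨U, hU, rfl⟩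
  have : (fun A : SE F => A.toCloseds) ∘ S ⁻¹' {A : Closeds F | ((A : Set F) ∩ U).Nonempty}
      = ⋃ i, f i ⁻¹' U := by
    ext ξ
    simp only [Set.mem_preimage, Function.comp_apply, Set.mem_ofPred_eq, Set.mem_iUnion,
      ClosedSubmodule.coe_toCloseds, hS]
    rw [closure_inter_open_nonempty_iff hU]
    constructor
    · rintro ⟨_, ⟨i, rfl⟩, hi⟩
      exact ⟨i, hi⟩
    · rintro ⟨i, hi⟩
      exact ⟨_, ⟨i, rfl⟩, hi⟩
  rw [this]
  exact MeasurableSet.iUnion fun i => hf i hU.measurableSet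

end Measurability

/-! ### A curve through the Hilbert cube -/

section Curve

/-- A Peano curve onto the Hilbert cube: extend a continuous surjection from the Cantor set by
Tietze's theorem. -/
lemma exists_continuous_surjective_unitInterval_hilbertCube :
    ∃ g : I → (ℕ → I), Continuous g ∧ Function.Surjective g := by
  let : MetricSpace (ℕ → I) := metrizableSpaceMetric _
  obtain ⟨f, hf, hfs⟩ := exists_nat_bool_continuous_surjective_of_compact (ℕ → I)
  let e : (ℕ → Bool) → I :=
    Set.inclusion cantorSet_subset_unitInterval ∘ cantorSetHomeomorphNatToBool.symm
  have he : IsClosedEmbedding e :=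
    ((continuous_inclusion _).comp cantorSetHomeomorphNatToBool.symm.continuous).isClosedEmbedding
      ((Set.inclusion_injective _).comp cantorSetHomeomorphNatToBool.symm.injective)
  obtain ⟨g, hg⟩ := ContinuousMap.exists_extension' he ⟨f, hf⟩
  refine ⟨g, g.continuous, fun q => ?_⟩
  obtain ⟨s, rfl⟩ := hfs q
  exact ⟨e s, congrFun hg s⟩

/-- The Hilbert cube `{h | |⟪b k, h⟫| ≤ 2⁻ᵏ}` of a Hilbert space with basis `b` is covered by a
continuous curve. -/
lemma exists_curve_covering_hilbertCube {H : Type*} [NormedAddCommGroup H] [InnerProductSpace ℝ H]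
    [CompleteSpace H] (b : HilbertBasis ℕ ℝ H) :
    ∃ γ : I → H, Continuous γ ∧ ∀ h, (∀ k, |⟪b k, h⟫| ≤ (1 / 2 : ℝ) ^ k) → ∃ t, γ t = h := by
  obtain ⟨g, hg, hgs⟩ := exists_continuous_surjective_unitInterval_hilbertCube
  refine ⟨fun t => ∑' k, ((1 / 2 : ℝ) ^ k * (2 * (g t k : ℝ) - 1)) • b k, ?_, fun h hh => ?_⟩
  · refine continuous_tsum (u := fun k => (1 / 2 : ℝ) ^ k) (fun k => ?_)
      (summable_geometric_of_lt_one (by norm_num) (by norm_num)) fun k t => ?_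
    · have : Continuous fun t => g t k := (continuous_apply k).comp hg
      fun_prop
    · rw [norm_smul, b.orthonormal.1 k, mul_one, norm_mul, norm_pow, Real.norm_eq_abs,
        Real.norm_eq_abs, abs_of_pos (by norm_num : (0 : ℝ) < 1 / 2)]
      have h₀ := (g t k).2.1
      have h₁ := (g t k).2.2
      exact mul_le_of_le_one_right (by positivity) (abs_le.2 ⟨by linarith, by linarith⟩)
  · have hk : ∀ k, (2 ^ k * ⟪b k, h⟫ + 1) / 2 ∈ I := fun k => by
      have h₁ : |2 ^ k * ⟪b k, h⟫| ≤ 1 := by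
        rw [abs_mul, abs_of_pos (by positivity : (0 : ℝ) < 2 ^ k)]
        calc (2 : ℝ) ^ k * |⟪b k, h⟫| ≤ 2 ^ k * (1 / 2) ^ k := by gcongr; exact hh k
          _ = 1 := by rw [← mul_pow]; norm_num
      have := abs_le.1 h₁
      constructor <;> linarith
    obtain ⟨t, ht⟩ := hgs fun k => ⟨_, hk k⟩
    refine ⟨t, (tsum_congr fun k => ?_).trans (b.hasSum_repr h).tsum_eq⟩
    rw [ht, b.repr_apply_apply]
    congr 1
    have : (1 / 2 : ℝ) ^ k * 2 ^ k = 1 := by rw [← mul_pow]; norm_num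
    linear_combination ⟪b k, h⟫ * this

lemma HilbertBasis.separableSpace {H : Type*} [NormedAddCommGroup H] [InnerProductSpace ℝ H]
    (b : HilbertBasis ℕ ℝ H) : SeparableSpace H := by
  have h := ((Set.countable_range b).isSeparable.span (R := ℝ)).closure
  rw [← Submodule.topologicalClosure_coe, b.dense_span, Submodule.top_coe] at h
  exact isSeparable_univ_iff.1 h

end Curve

/-! ### The embedding into continuous functions -/

section Embedding

variable {H E : Type*} [NormedAddCommGroup H] [InnerProductSpace ℝ H] [CompleteSpace H]
  [NormedAddCommGroup E] [NormedSpace ℝ E]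

/-- The linear map `H → C([0,1], ℝ)` that evaluates `c : H` along the projection onto
`adjointBall T` of the curve `γ`. -/
noncomputable def curveEval (T : H →L[ℝ] E) (γ : C(I, H)) : H →ₗ[ℝ] C(I, ℝ) where
  toFun c := ⟨fun t => ⟪adjointBallProj T (γ t), c⟫,
    ((continuous_adjointBallProj T).comp γ.continuous).inner continuous_const⟩
  map_add' c d := by ext t; simp [inner_add_right]
  map_smul' a c := by ext t; simp [inner_smul_right]

lemma norm_curveEval (T : H →L[ℝ] E) {γ : C(I, H)} (hγ : adjointBall T ⊆ Set.range γ) (c : H) :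
    ‖curveEval T γ c‖ = ‖T c‖ := by
  refine le_antisymm ((ContinuousMap.norm_le _ (norm_nonneg _)).2 fun t => ?_) ?_
  · change ‖⟪adjointBallProj T (γ t), c⟫‖ ≤ _
    rw [real_inner_comm]
    exact abs_inner_le_of_mem_adjointBall (adjointBallProj_mem T _) c
  · obtain ⟨h, hh, he⟩ := exists_mem_adjointBall_inner_eq T c
    obtain ⟨t, rfl⟩ := hγ hh
    have : curveEval T γ c t = ‖T c‖ := by
      change ⟪adjointBallProj T (γ t), c⟫ = _
      rw [adjointBallProj_of_mem hh, real_inner_comm, he]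
    rw [← this]
    exact (le_abs_self _).trans ((curveEval T γ c).norm_coe_le_norm t)

/-- The closure of the range of `curveEval T γ`, as a closed subspace of `C([0,1], ℝ)`. -/
noncomputable def curveSpace (T : H →L[ℝ] E) (γ : C(I, H)) : SE C(I, ℝ) :=
  (LinearMap.range (curveEval T γ)).closure

lemma nonempty_linearIsometryEquiv_curveSpace [CompleteSpace E] (T : H →L[ℝ] E)
    (hT : DenseRange T) {γ : C(I, H)} (hγ : adjointBall T ⊆ Set.range γ) :
    Nonempty (E ≃ₗᵢ[ℝ] (curveSpace T γ).toSubmodule) := by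
  have hmem : ∀ c, curveEval T γ c ∈ (curveSpace T γ).toSubmodule := fun c =>
    subset_closure (LinearMap.mem_range_self _ c)
  let J : H →ₗ[ℝ] (curveSpace T γ).toSubmodule := (curveEval T γ).codRestrict _ hmem
  have hJ : DenseRange J := by
    intro y
    rw [closure_subtype, ← Set.range_comp]
    exact y.2
  have : CompleteSpace (curveSpace T γ).toSubmodule :=
    (curveSpace T γ).isClosed.completeSpace_coe
  exact ⟨(LinearEquiv.refl ℝ H).extendOfIsometry T.toLinearMap J hT hJ fun c =>
    norm_curveEval T hγ c⟩

end Embedding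

/-! ### Operators sending a Hilbert basis to a summable sequence -/

section WeightedSum

variable {H E : Type*} [NormedAddCommGroup H] [InnerProductSpace ℝ H]
  [NormedAddCommGroup E] [NormedSpace ℝ E] [CompleteSpace E]

/-- For a sequence `y` in a Banach space with `‖y k‖ ≤ 2⁻ᵏ` there is a bounded operator with
`b k ↦ y k`. -/
lemma HilbertBasis.exists_hasSum_inner_smul (b : HilbertBasis ℕ ℝ H) (y : ℕ → E)
    (hy : ∀ k, ‖y k‖ ≤ (1 / 2 : ℝ) ^ k) :
    ∃ T : H →L[ℝ] E, (∀ c, HasSum (fun k => ⟪b k, c⟫ • y k) (T c)) ∧ ∀ k, T (b k) = y k := by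
  have hs : Summable fun k => (innerSL ℝ (b k)).smulRight (y k) := by
    refine Summable.of_norm_bounded
      (summable_geometric_of_lt_one (by norm_num : (0 : ℝ) ≤ 1 / 2) (by norm_num)) fun k => ?_
    rw [ContinuousLinearMap.norm_smulRight_apply, innerSL_apply_norm, b.orthonormal.1 k, one_mul]
    exact hy k
  have hsum : ∀ c, HasSum (fun k => ⟪b k, c⟫ • y k)
      ((∑' k, (innerSL ℝ (b k)).smulRight (y k)) c) := fun c => by
    simpa using hs.hasSum.mapL (ContinuousLinearMap.apply ℝ E c)
  refine ⟨_, hsum, fun k => (hsum (b k)).unique ?_⟩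
  convert hasSum_single k fun j hj => ?_ using 1
  · simp [b.orthonormal.1 k]
  · rw [b.orthonormal.2 hj, zero_smul]

end WeightedSum

/-! ### The Borel selection of isometric copies -/

theorem mainTheorem6 {Ξ : Type*} [MeasurableSpace Ξ] [StandardBorelSpace Ξ]
    (X : Ξ → Type*) [∀ ξ, NormedAddCommGroup (X ξ)] [∀ ξ, NormedSpace ℝ (X ξ)]
    [∀ ξ, CompleteSpace (X ξ)]
    (x : ∀ ξ, ℕ → X ξ)
    (hdense : ∀ ξ, Dense (Submodule.span ℝ (Set.range (x ξ)) : Set (X ξ)))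
    (hborel : ∀ (n : ℕ) (c : Fin n → ℝ), Measurable fun ξ => ‖∑ k : Fin n, c k • x ξ k‖) :
    ∃ S : Ξ → SE C(Set.Icc (0 : ℝ) 1, ℝ),
      Measurable S ∧ ∀ ξ, Nonempty (X ξ ≃ₗᵢ[ℝ] (S ξ).toSubmodule) := by
  let : MeasurableSpace C(I, ℝ) := borel _
  have : BorelSpace C(I, ℝ) := ⟨rfl⟩
  let b : HilbertBasis ℕ ℝ (lp (fun _ : ℕ => ℝ) 2) := default
  have := b.separableSpace
  obtain ⟨γ, hγ, hγr⟩ := exists_curve_covering_hilbertCube b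
  -- The summand `1` in the denominator keeps the factors positive and defined when `x ξ k = 0`.
  let s : ℕ → Ξ → ℝ := fun k ξ => (1 / 2) ^ k / (1 + ‖x ξ k‖)
  have hspos : ∀ k ξ, 0 < s k ξ := fun k ξ => by positivity
  have hynorm : ∀ ξ k, ‖s k ξ • x ξ k‖ ≤ (1 / 2 : ℝ) ^ k := fun ξ k => by
    rw [norm_smul, Real.norm_of_nonneg (hspos k ξ).le, div_mul_eq_mul_div]
    exact div_le_of_le_mul₀ (by positivity) (by positivity) (by gcongr; linarith)
  have hxmeas : ∀ k, Measurable fun ξ => ‖x ξ k‖ := fun k => by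
    simpa [Fin.sum_univ_castSucc] using
      hborel (k + 1) (fun j => if j = Fin.last k then 1 else 0)
  have hsmeas : ∀ k, Measurable (s k) := fun k => ((hxmeas k).const_add 1).const_div _
  -- The norm of a combination is continuous in the coefficients, so measurable coefficients
  -- are allowed as well.
  have hcomb : ∀ (n : ℕ) (a : Fin n → Ξ → ℝ), (∀ k, Measurable (a k)) →
      Measurable fun ξ => ‖∑ k : Fin n, a k ξ • x ξ k‖ := fun n a ha => by
    have := MeasureTheory.measurable_uncurry_of_continuous_of_measurable
      (u := fun (c : Fin n → ℝ) ξ => ‖∑ k : Fin n, c k • x ξ k‖)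
      (fun ξ => by fun_prop) (hborel n)
    exact this.comp ((measurable_pi_lambda _ ha).prodMk measurable_id)
  choose T hTsum hTb using fun ξ =>
    b.exists_hasSum_inner_smul (fun k => s k ξ • x ξ k) (hynorm ξ)
  have hTdense : ∀ ξ, DenseRange (T ξ) := fun ξ => by
    refine (hdense ξ).mono ?_
    change _ ⊆ ((LinearMap.range (T ξ).toLinearMap : Submodule ℝ (X ξ)) : Set (X ξ))
    refine Submodule.span_le.2 ?_
    rintro _ ⟨k, rfl⟩
    refine ⟨(s k ξ)⁻¹ • b k, ?_⟩
    simp [hTb, smul_smul, inv_mul_cancel₀ (hspos k ξ).ne']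
  have hTmeas : ∀ c, Measurable fun ξ => ‖T ξ c‖ := fun c => by
    refine measurable_of_tendsto_metrizable
      (f := fun n ξ => ‖∑ k : Fin n, (⟪b k, c⟫ * s k ξ) • x ξ k‖) (fun n =>
        hcomb n (fun k ξ => ⟪b k, c⟫ * s k ξ) fun k => (hsmeas k).const_mul _)
      (tendsto_pi_nhds.2 fun ξ => ?_)
    have := (hTsum ξ c).tendsto_sum_nat.norm
    refine this.congr fun n => ?_
    rw [← Fin.sum_univ_eq_sum_range (fun k => ⟪b k, c⟫ • s k ξ • x ξ k)]
    simp only [smul_smul]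
  have hcover : ∀ ξ, adjointBall (T ξ) ⊆ Set.range (⟨γ, hγ⟩ : C(I, _)) := fun ξ h hh =>
    hγr h fun k => (abs_inner_le_of_mem_adjointBall hh _).trans (by rw [hTb]; exact hynorm ξ k)
  refine ⟨fun ξ => curveSpace (T ξ) ⟨γ, hγ⟩, ?_, fun ξ =>
    nonempty_linearIsometryEquiv_curveSpace _ (hTdense ξ) (hcover ξ)⟩
  refine measurable_SE_of_selectors
    (fun i ξ => curveEval (T ξ) ⟨γ, hγ⟩ (denseSeq (lp (fun _ : ℕ => ℝ) 2) i))
    (fun i => measurable_continuousMap_of_eval fun t =>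
      measurable_inner_adjointBallProj T hTmeas _ _) fun ξ => ?_
  have hcont : Continuous (curveEval (T ξ) ⟨γ, hγ⟩) :=
    AddMonoidHomClass.continuous_of_bound _ ‖T ξ‖ fun c => by
      rw [norm_curveEval _ (hcover ξ)]; exact (T ξ).le_opNorm c
  change closure (Set.range _) = closure (Set.range (curveEval (T ξ) ⟨γ, hγ⟩ ∘ denseSeq _))
  refine subset_antisymm (closure_minimal ?_ isClosed_closure)
    (closure_mono (Set.range_comp_subset_range _ _))
  exact hcont.range_subset_closure_image_dense (denseRange_denseSeq _) |>.trans_eq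
    (by rw [Set.range_comp])
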